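/- Conventions. Manifolds are smooth ($C^\infty$), real, finite-dimensional, Hausdorff and second-countable; all maps, connections and curves are smooth. Let $\pi:Q\to\mathbb R$ be a smooth fibre bundle (locally trivial, with typical fibre a manifold $M$), let $t$ be the Cartesian coordinate on $\mathbb R$, and let $(q^\lambda)=(q^0=t,q^i)$ be bundle coordinates on $Q$. The first order jet manifold $J^1Q$ of sections of $\pi$, with coordinates $(t,q^i,q^i_t)$, is identified with the closed submanifold $\{\dot t=1\}$ of $TQ$ by the imbedding $\lambda_{(1)}:(t,q^i,q^i_t)\mapsto(t,q^i,\dot t=1,\dot q^i=q^i_t)$. A second order dynamic equation on $Q\to\mathbb R$, written $q^i_{tt}=\xi^i(t,q^j,q^j_t)$, is a holonomic vector field $\xi=\partial_t+q^i_t\partial_i+\xi^i\partial^t_i$ on $J^1Q$. Its solutions are the local sections $c:J\to Q$ of $\pi$ on open intervals $J\subseteq\mathbb R$ with $\ddot c^i=\xi^i\circ\dot c$, that is, such that the jet prolongation $\dot c$ is an integral curve of $\xi$. A dynamic connection is a connection $\gamma=dq^\lambda\otimes(\partial_\lambda+\gamma^i_\lambda\partial^t_i)$ on $J^1Q\to Q$;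 it yields the dynamic equation $q^i_{tt}=\gamma^i_0+q^j_t\gamma^i_j$. Given a (not necessarily linear) connection $K=dq^\lambda\otimes(\partial_\lambda+K^\mu_\lambda\dot\partial_\mu)$ on $TQ\to Q$, regarded as a splitting $TQ\times_QTQ\to TTQ$, its geodesic equation is the vector field on $TQ$ obtained by restricting the splitting to the diagonal, $\ddot q^\mu=K^\mu_\lambda(q^\nu,\dot q^\nu)\dot q^\lambda$; its geodesic curves are the curves $c$ in $Q$ whose tangent prolongation $\dot c$ is an integral curve of this vector field. Theorem 1.5. Let $q^i_{tt}=\xi^i$ be a second order dynamic equation on $Q\to\mathbb R$. There exists a dynamic connection $\gamma$ yielding it. For every such $\gamma$ there exists a connection $\widetilde K$ on $TQ\to Q$ with $$K^0_\lambda=0,\qquad \gamma^i_\mu=K^i_\mu\circ\lambda_{(1)}.$$ For every such $\gamma$ and every such $\widetilde K$, the dynamic equation is equivalent to the geodesic equation $$\ddot q^0=0,\qquad \dot q^0=1,\qquad \ddot q^i=K^i_\lambda(q^\mu,\dot q^\mu)\dot q^\lambda$$ in the following sense. (a) $\xi$ coincides on $J^1Q\subset TQ$ with the geodesic vector field of $\widetilde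 K$, i.e. $\xi^i=K^i_0\circ\lambda_{(1)}+q^j_tK^i_j\circ\lambda_{(1)}$. (b) A curve $c:J\to Q$ on an open interval is a solution of the dynamic equation if and only if it is a section of $\pi$ over $J$ and a geodesic curve of $\widetilde K$ with $\dot q^0=1$. (c) Every geodesic curve $c:J\to Q$ of $\widetilde K$ with $\dot q^0=1$ becomes a solution of the dynamic equation after a shift of its parameter: there is $a\in\mathbb R$ such that $t\mapsto c(t-a)$ is a solution on $J+a$. -/

import Mathlib

open scoped Manifold ContDiff Bundle

noncomputable section

namespace NonRelMech

section FibreBundle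

variable {E : Type*} [NormedAddCommGroup E] [NormedSpace ℝ E]
  {Q : Type*} [TopologicalSpace Q] [ChartedSpace E Q]

/-- `pr : Q → ℝ` is a smooth fibre bundle with typical fibre the manifold `M`: around every instant
there is a local trivialization `pr ⁻¹(U) ≃ U × M` over `U` which is smooth in both directions. -/
def IsSmoothFibreBundle (F : Type*) [NormedAddCommGroup F] [NormedSpace ℝ F]
    (M : Type*) [TopologicalSpace M] [ChartedSpace F M] (pr : Q → ℝ) : Prop :=
  ∀ t : ℝ, ∃ e : Bundle.Trivialization M pr, t ∈ e.baseSet ∧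
    ContMDiffOn 𝓘(ℝ, E) (𝓘(ℝ, ℝ).prod 𝓘(ℝ, F)) ∞ e e.source ∧
    ContMDiffOn (𝓘(ℝ, ℝ).prod 𝓘(ℝ, F)) 𝓘(ℝ, E) ∞ e.toOpenPartialHomeomorph.symm e.target

/-- The global function `ṫ : TQ → ℝ`, i.e. `v ↦ dt ⌋ v`, where `dt` is pulled back to `Q`. -/
def tdot (pr : Q → ℝ) (v : TangentBundle 𝓘(ℝ, E) Q) : ℝ :=
  mfderiv 𝓘(ℝ, E) 𝓘(ℝ, ℝ) pr v.proj v.2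

/-- The first order jet manifold `J¹Q` of sections of `pr : Q → ℝ`, identified with its image
`{ṫ = 1}` under the canonical imbedding
`λ₍₁₎ : J¹Q → TQ, (t, qⁱ, qⁱ_t) ↦ (t, qⁱ, ṫ = 1, q̇ⁱ = qⁱ_t)`; the jet of a section `s` at `t`
corresponds to the velocity `ds/dt`. It is a closed imbedded submanifold of `TQ`, so a map on it
is smooth iff it is `ContMDiffOn` this set. -/
def jetSpace (pr : Q → ℝ) : Set (TangentBundle 𝓘(ℝ, E) Q) :=
  {v | tdot pr v = 1}

end FibreBundle

section Equations

variable {E : Type*} [NormedAddCommGroup E] [NormedSpace ℝ E]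
  {Q : Type*} [TopologicalSpace Q] [ChartedSpace E Q] [IsManifold 𝓘(ℝ, E) ∞ Q]

/-- The tangent map `TTQ → TQ` of the projection `TQ → Q` at `v ∈ TQ`; in coordinates it sends a
tangent vector to `TQ` to its components along `∂_λ`. -/
def dproj (v : TangentBundle 𝓘(ℝ, E) Q) :
    TangentSpace 𝓘(ℝ, E).tangent v →L[ℝ] TangentSpace 𝓘(ℝ, E) v.proj :=
  mfderiv 𝓘(ℝ, E).tangent 𝓘(ℝ, E)
    (fun w : TangentBundle 𝓘(ℝ, E) Q => w.proj) v

/-- The differential of the function `ṫ` on `TQ` at `v ∈ TQ`. In coordinates, it is the component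
along `∂/∂ṫ`; its kernel at `v ∈ J¹Q` is the tangent space of `J¹Q ⊆ TQ`. -/
def dtdot (pr : Q → ℝ) (v : TangentBundle 𝓘(ℝ, E) Q) :
    TangentSpace 𝓘(ℝ, E).tangent v →L[ℝ] ℝ :=
  mfderiv 𝓘(ℝ, E).tangent 𝓘(ℝ, ℝ) (tdot pr) v

/-- A second order dynamic equation on `pr : Q → ℝ`: a holonomic connection on `J¹Q → ℝ`, i.e. a
smooth vector field `ξ = ∂_t + qⁱ_t ∂_i + ξⁱ ∂ᵗ_i` on `J¹Q`. Only the values of `toFun` on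
`J¹Q` matter. The condition `tangent` says that `ξ` is tangent to `J¹Q`; the condition `holonomic`
says that its components along `∂_t` and `∂_i` are `1` and `qⁱ_t`. -/
structure DynamicEquation (pr : Q → ℝ) where
  toFun : ∀ v : TangentBundle 𝓘(ℝ, E) Q, TangentSpace 𝓘(ℝ, E).tangent v
  smooth : ContMDiffOn 𝓘(ℝ, E).tangent 𝓘(ℝ, E).tangent.tangent ∞
    (fun v => (⟨v, toFun v⟩ : TangentBundle 𝓘(ℝ, E).tangent (TangentBundle 𝓘(ℝ, E) Q)))
    (jetSpace pr)
  tangent : ∀ v ∈ jetSpace (E := E) pr, dtdot pr v (toFun v) = 0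
  holonomic : ∀ v ∈ jetSpace (E := E) pr, dproj v (toFun v) = v.2

/-- A dynamic connection: a connection `γ = dq^λ ⊗ (∂_λ + γⁱ_λ ∂ᵗ_i)` on the affine jet bundle
`J¹Q → Q`, as a horizontal splitting `J¹Q ×_Q TQ → TJ¹Q` over `J¹Q`, fibrewise linear in the second
factor. Only the values of `toFun` on `J¹Q` matter. -/
structure DynamicConnection (pr : Q → ℝ) where
  toFun : ∀ v : TangentBundle 𝓘(ℝ, E) Q,
    TangentSpace 𝓘(ℝ, E) v.proj →L[ℝ] TangentSpace 𝓘(ℝ, E).tangent v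
  smooth : ContMDiffOn (𝓘(ℝ, E).prod 𝓘(ℝ, E × E)) 𝓘(ℝ, E).tangent.tangent ∞
    (fun p : Bundle.TotalSpace (E × E)
        ((TangentSpace 𝓘(ℝ, E) : Q → Type _) ×ᵇ (TangentSpace 𝓘(ℝ, E) : Q → Type _)) =>
      (⟨⟨p.1, p.2.1⟩, toFun ⟨p.1, p.2.1⟩ p.2.2⟩ :
        TangentBundle 𝓘(ℝ, E).tangent (TangentBundle 𝓘(ℝ, E) Q)))
    {p | (⟨p.1, p.2.1⟩ : TangentBundle 𝓘(ℝ, E) Q) ∈ jetSpace pr}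
  tangent : ∀ v ∈ jetSpace (E := E) pr, ∀ u, dtdot pr v (toFun v u) = 0
  horizontal : ∀ v ∈ jetSpace (E := E) pr, ∀ u, dproj v (toFun v u) = u

/-- The dynamic connection `γ` yields the dynamic equation `ξ`:
`ξⁱ = γⁱ_0 + qʲ_t γⁱ_j`, i.e. `ξ` at `v ∈ J¹Q` is the horizontal lift of `v` itself. -/
def DynamicConnection.Yields {pr : Q → ℝ} (γ : DynamicConnection (E := E) pr)
    (ξ : DynamicEquation (E := E) pr) : Prop :=
  ∀ v ∈ jetSpace (E := E) pr, γ.toFun v v.2 = ξ.toFun v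

variable (E Q) in
/-- A (not necessarily linear) connection `K = dq^λ ⊗ (∂_λ + K^μ_λ ∂̇_μ)` on the tangent bundle
`TQ → Q`, as a horizontal splitting `TQ ×_Q TQ → TTQ` over `TQ`, fibrewise linear in the second
factor. -/
structure TangentConnection where
  toFun : ∀ v : TangentBundle 𝓘(ℝ, E) Q,
    TangentSpace 𝓘(ℝ, E) v.proj →L[ℝ] TangentSpace 𝓘(ℝ, E).tangent v
  smooth : ContMDiff (𝓘(ℝ, E).prod 𝓘(ℝ, E × E)) 𝓘(ℝ, E).tangent.tangent ∞
    (fun p : Bundle.TotalSpace (E × E)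
        ((TangentSpace 𝓘(ℝ, E) : Q → Type _) ×ᵇ (TangentSpace 𝓘(ℝ, E) : Q → Type _)) =>
      (⟨⟨p.1, p.2.1⟩, toFun ⟨p.1, p.2.1⟩ p.2.2⟩ :
        TangentBundle 𝓘(ℝ, E).tangent (TangentBundle 𝓘(ℝ, E) Q)))
  horizontal : ∀ v u, dproj v (toFun v u) = u

/-- The components `K⁰_λ` of the connection `K` vanish. -/
def TangentConnection.TimeComponentsVanish (K : TangentConnection E Q) (pr : Q → ℝ) : Prop :=
  ∀ v u, dtdot pr v (K.toFun v u) = 0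

/-- The relation `γⁱ_μ = Kⁱ_μ ∘ λ₍₁₎`: the connection `K` restricted to `J¹Q ⊆ TQ` is `γ`. -/
def TangentConnection.Extends {pr : Q → ℝ} (K : TangentConnection E Q)
    (γ : DynamicConnection (E := E) pr) : Prop :=
  ∀ v ∈ jetSpace (E := E) pr, ∀ u, K.toFun v u = γ.toFun v u

/-- The geodesic equation on `TQ` with respect to `K`, `q̈^μ = K^μ_λ q̇^λ`, as a vector field on `TQ`:
the restriction of the splitting `TQ ×_Q TQ → TTQ` to the diagonal. -/
def TangentConnection.geodesicField (K : TangentConnection E Q)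
    (v : TangentBundle 𝓘(ℝ, E) Q) : TangentSpace 𝓘(ℝ, E).tangent v :=
  K.toFun v v.2

variable (E) in
/-- The tangent prolongation `ċ : τ ↦ (c(τ), dc/dτ)` of a curve `c` in `Q`. -/
def prolong (c : ℝ → Q) (τ : ℝ) : TangentBundle 𝓘(ℝ, E) Q :=
  ⟨c τ, mfderiv 𝓘(ℝ, ℝ) 𝓘(ℝ, E) c τ (1 : ℝ)⟩

/-- `c` is a solution on the open interval `J` of the dynamic equation `ξ`: it is a smooth local
section of `pr : Q → ℝ`, and `d/dt ċ = ξ(ċ)`, i.e. `c̈ⁱ = ξⁱ(t, c, ċ)`. -/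
def DynamicEquation.IsSolutionOn {pr : Q → ℝ} (ξ : DynamicEquation (E := E) pr)
    (c : ℝ → Q) (J : Set ℝ) : Prop :=
  ContMDiffOn 𝓘(ℝ, ℝ) 𝓘(ℝ, E) ∞ c J ∧ (∀ t ∈ J, pr (c t) = t) ∧
    IsMIntegralCurveOn (I := 𝓘(ℝ, E).tangent) (prolong E c) ξ.toFun J

/-- `c` is a geodesic curve of `K` on the open interval `J`: it is smooth and its tangent
prolongation satisfies `d/dτ ċ = K(ċ, ċ)`. -/
def TangentConnection.IsGeodesicOn (K : TangentConnection E Q)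
    (c : ℝ → Q) (J : Set ℝ) : Prop :=
  ContMDiffOn 𝓘(ℝ, ℝ) 𝓘(ℝ, E) ∞ c J ∧
    IsMIntegralCurveOn (I := 𝓘(ℝ, E).tangent) (prolong E c) K.geodesicField J

/-- `c` is a solution on the open interval `J` of the system `q̇⁰ = 1`, `q̈^μ = K^μ_λ q̇^λ`. -/
def TangentConnection.IsUnitTimeGeodesicOn (K : TangentConnection E Q) (pr : Q → ℝ)
    (c : ℝ → Q) (J : Set ℝ) : Prop :=
  K.IsGeodesicOn c J ∧ ∀ τ ∈ J, tdot pr (prolong E c τ) = 1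

end Equations

end NonRelMech

end

/-!
Since `pr` is a submersion, there is a *reference frame*: a vector field
`X` on `Q` with `dt(X) = 1` (`exists_referenceFrame`). Translating along `X` in the fibres of `TQ`,
`(s, v) ↦ v + s X`, changes `ṫ` by `s`; so it moves every `v ∈ TQ` into `J¹Q = {ṫ = 1}` and back.

Extension of a dynamic connection `γ` to `TQ` (`DynamicConnection.extend`): the lift of `u` at `v` is
obtained by lifting `u` with `γ` at the translate `r(v) ∈ J¹Q` of `v` and carrying the result back
to `v` by the tangent map of the translation by the fixed amount `ṫ(v) - 1`. This translation
covers the identity of `Q` and shifts `ṫ` by a constant, so the lift stays horizontal and stays in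
the kernel of `dṫ`; at `v ∈ J¹Q` the translation is the identity.

Existence of a dynamic connection yielding `ξ`: for any connection `K` on `TQ` with `K⁰_λ = 0`, the
formula `γ(v, u) = K(v, u) + dt(u) (ξ(v) - K(v, v))` defines one, because `ξ(v) - K(v, v)` is
vertical and `dt(v) = 1` on `J¹Q` (`TangentConnection.toDynamicConnection`).

Such a `K` is obtained without Christoffel symbols (`exists_tangentConnection`). A partition of unity
on `TQ × Q` provides a smooth family `V(v, ·)` of vector fields on `Q` with `V(v, π(v)) = v` and with
`dt(V(v, ·))` constant (`exists_fibre_extension`); these are convex conditions on each value of `V`,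
and near the diagonal they are met by vector fields that are constant in a trivialization of `TQ`,
corrected along `X`. Then `K(v, u)` is the derivative of `V(v, ·)` at `π(v)` in the direction `u`.

The statements on curves rest on `d(pr ∘ c)/dτ = ṫ(ċ)`: a local section has its prolongation in
`J¹Q`, where `ξ` is the geodesic field, and along a geodesic with `ṫ = 1` the function `pr ∘ c` is
`τ + a` for a constant `a`.
-/

namespace NonRelMech

open Bundle Set Filter Topology

/-! ### Maps into total spaces of bundles -/

section Topology

variable {B : Type*} [TopologicalSpace B]

theorem t2Space_totalSpace (F : Type*) (V : B → Type*) [TopologicalSpace F]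
    [TopologicalSpace (TotalSpace F V)] [∀ x, TopologicalSpace (V x)] [FiberBundle F V]
    [T2Space B] [T2Space F] : T2Space (TotalSpace F V) := by
  refine ⟨fun p q hpq => ?_⟩
  by_cases h : p.proj = q.proj
  · set e := trivializationAt F V p.proj
    have hp : p ∈ e.source := e.mem_source.2 (mem_baseSet_trivializationAt F V p.proj)
    have hq : q ∈ e.source := e.mem_source.2 (h ▸ mem_baseSet_trivializationAt F V p.proj)
    obtain ⟨u, v, hu, hv, hpu, hqv, huv⟩ := t2_separation fun he => hpq (e.injOn hp hq he)
    exact ⟨_, _, e.isOpen_inter_preimage hu, e.isOpen_inter_preimage hv, ⟨hp, hpu⟩, ⟨hq, hqv⟩,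
      (huv.preimage e).mono inter_subset_right inter_subset_right⟩
  · exact separated_by_continuous (FiberBundle.continuous_proj F V) h

theorem secondCountableTopology_totalSpace (F : Type*) (V : B → Type*) [TopologicalSpace F]
    [TopologicalSpace (TotalSpace F V)] [∀ x, TopologicalSpace (V x)] [FiberBundle F V]
    [SecondCountableTopology B] [SecondCountableTopology F] :
    SecondCountableTopology (TotalSpace F V) := by
  obtain ⟨s, hs, hU⟩ := TopologicalSpace.countable_cover_nhds fun x : B =>
    (trivializationAt F V x).open_baseSet.mem_nhds (mem_baseSet_trivializationAt F V x)
  have := hs.to_subtype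
  have (i : s) : SecondCountableTopology (trivializationAt F V (i : B)).source :=
    Homeomorph.secondCountableTopology
      (trivializationAt F V (i : B)).toOpenPartialHomeomorph.toHomeomorphSourceTarget
  refine TopologicalSpace.secondCountableTopology_of_countable_cover
    (fun i : s => (trivializationAt F V (i : B)).open_source) (eq_univ_of_forall fun p => ?_)
  obtain ⟨x, hx, hp⟩ := mem_iUnion₂.1 (hU.symm ▸ mem_univ p.proj)
  exact mem_iUnion.2 ⟨⟨x, hx⟩, (Trivialization.mem_source _).2 hp⟩

end Topology

section VectorBundle

variable {EB : Type*} [NormedAddCommGroup EB] [NormedSpace ℝ EB]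
  {HB : Type*} [TopologicalSpace HB] {IB : ModelWithCorners ℝ EB HB}
  {B : Type*} [TopologicalSpace B] [ChartedSpace HB B]
  {F : Type*} [NormedAddCommGroup F] [NormedSpace ℝ F]
  {V : B → Type*} [∀ x, AddCommGroup (V x)] [∀ x, TopologicalSpace (V x)]
  [TopologicalSpace (TotalSpace F V)] [FiberBundle F V]
  {EN : Type*} [NormedAddCommGroup EN] [NormedSpace ℝ EN]
  {HN : Type*} [TopologicalSpace HN] {IN : ModelWithCorners ℝ EN HN}
  {N : Type*} [TopologicalSpace N] [ChartedSpace HN N]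
  {n : WithTop ℕ∞}

theorem contMDiffWithinAt_pullback_section {f : N → B} (hf : Continuous f)
    {s : ∀ x, V (f x)} {S : Set N} {x₀ : N}
    (h : ContMDiffWithinAt IN (IB.prod 𝓘(ℝ, F)) n (fun x => (⟨f x, s x⟩ : TotalSpace F V)) S x₀) :
    ContMDiffWithinAt IN (IN.prod 𝓘(ℝ, F)) n
      (fun x => (⟨x, s x⟩ : TotalSpace F ((⟨f, hf⟩ : C(N, B)) *ᵖ V))) S x₀ :=
  contMDiffWithinAt_section.2 (contMDiffWithinAt_totalSpace.1 h).2

theorem contMDiff_of_pullback_section {f : N → B} (hf : ContMDiff IN IB n f)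
    {s : ∀ x, V (f x)}
    (h : ContMDiff IN (IN.prod 𝓘(ℝ, F)) n
      (fun x => (⟨x, s x⟩ : TotalSpace F ((⟨f, hf.continuous⟩ : C(N, B)) *ᵖ V)))) :
    ContMDiff IN (IB.prod 𝓘(ℝ, F)) n (fun x => (⟨f x, s x⟩ : TotalSpace F V)) := fun x₀ =>
  contMDiffAt_totalSpace.2 ⟨hf x₀, (contMDiffAt_section x₀).1 (h x₀)⟩

variable {F₂ : Type*} [NormedAddCommGroup F₂] [NormedSpace ℝ F₂]
  {V₂ : B → Type*} [∀ x, AddCommGroup (V₂ x)]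
  [∀ x, TopologicalSpace (V₂ x)]
  [TopologicalSpace (TotalSpace F₂ V₂)] [FiberBundle F₂ V₂]

theorem contMDiff_prod_fst : ContMDiff (IB.prod 𝓘(ℝ, F × F₂)) (IB.prod 𝓘(ℝ, F)) n
    (fun p : TotalSpace (F × F₂) (V ×ᵇ V₂) => (⟨p.1, p.2.1⟩ : TotalSpace F V)) := fun p => by
  have h := contMDiffAt_totalSpace.1
    (contMDiffAt_id (I := IB.prod 𝓘(ℝ, F × F₂)) (n := n) (x := p))
  exact contMDiffAt_totalSpace.2 ⟨h.1, contDiff_fst.contMDiff.contMDiffAt.comp p h.2⟩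

theorem contMDiff_prod_snd : ContMDiff (IB.prod 𝓘(ℝ, F × F₂)) (IB.prod 𝓘(ℝ, F₂)) n
    (fun p : TotalSpace (F × F₂) (V ×ᵇ V₂) => (⟨p.1, p.2.2⟩ : TotalSpace F₂ V₂)) := fun p => by
  have h := contMDiffAt_totalSpace.1
    (contMDiffAt_id (I := IB.prod 𝓘(ℝ, F × F₂)) (n := n) (x := p))
  refine contMDiffAt_totalSpace.2 ⟨h.1, ?_⟩
  exact (contDiff_snd (𝕜 := ℝ) (E := F) (F := F₂)).contMDiff.contMDiffAt.comp p h.2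

theorem contMDiffOn_prod_mk {b : N → B} {s : ∀ x, V (b x)} {t : ∀ x, V₂ (b x)} {S : Set N}
    (hs : ContMDiffOn IN (IB.prod 𝓘(ℝ, F)) n (fun x => (⟨b x, s x⟩ : TotalSpace F V)) S)
    (ht : ContMDiffOn IN (IB.prod 𝓘(ℝ, F₂)) n (fun x => (⟨b x, t x⟩ : TotalSpace F₂ V₂)) S) :
    ContMDiffOn IN (IB.prod 𝓘(ℝ, F × F₂)) n
      (fun x => (⟨b x, (s x, t x)⟩ : TotalSpace (F × F₂) (V ×ᵇ V₂))) S := fun x hx => by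
  have hs' := contMDiffWithinAt_totalSpace.1 (hs x hx)
  have ht' := contMDiffWithinAt_totalSpace.1 (ht x hx)
  exact contMDiffWithinAt_totalSpace.2 ⟨hs'.1, hs'.2.prodMk_space ht'.2⟩

variable [∀ x, Module ℝ (V x)] [VectorBundle ℝ F V]

theorem contMDiffWithinAt_add_smul {b : N → B} {s t : ∀ x, V (b x)} {a : N → ℝ} {S : Set N}
    {x₀ : N}
    (hs : ContMDiffWithinAt IN (IB.prod 𝓘(ℝ, F)) n (fun x => (⟨b x, s x⟩ : TotalSpace F V)) S x₀)
    (ht : ContMDiffWithinAt IN (IB.prod 𝓘(ℝ, F)) n (fun x => (⟨b x, t x⟩ : TotalSpace F V)) S x₀)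
    (ha : ContMDiffWithinAt IN 𝓘(ℝ, ℝ) n a S x₀) :
    ContMDiffWithinAt IN (IB.prod 𝓘(ℝ, F)) n
      (fun x => (⟨b x, s x + a x • t x⟩ : TotalSpace F V)) S x₀ := by
  rw [contMDiffWithinAt_totalSpace] at hs ht ⊢
  refine ⟨hs.1, ?_⟩
  set e := trivializationAt F V (b x₀)
  have key : ∀ x, b x ∈ e.baseSet → (e ⟨b x, s x + a x • t x⟩).2 =
      (e ⟨b x, s x⟩).2 + a x • (e ⟨b x, t x⟩).2 := fun x hx => by
    rw [(e.linear ℝ hx).map_add, (e.linear ℝ hx).map_smul]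
  refine (hs.2.add (ha.smul ht.2)).congr_of_eventuallyEq ?_ ?_
  · filter_upwards [hs.1.continuousWithinAt (e.open_baseSet.mem_nhds
      (mem_baseSet_trivializationAt F V (b x₀)))] with x hx using key x hx
  · exact key x₀ (mem_baseSet_trivializationAt F V (b x₀))

theorem contMDiffOn_add_smul {b : N → B} {s t : ∀ x, V (b x)} {a : N → ℝ} {S : Set N}
    (hs : ContMDiffOn IN (IB.prod 𝓘(ℝ, F)) n (fun x => (⟨b x, s x⟩ : TotalSpace F V)) S)
    (ht : ContMDiffOn IN (IB.prod 𝓘(ℝ, F)) n (fun x => (⟨b x, t x⟩ : TotalSpace F V)) S)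
    (ha : ContMDiffOn IN 𝓘(ℝ, ℝ) n a S) :
    ContMDiffOn IN (IB.prod 𝓘(ℝ, F)) n
      (fun x => (⟨b x, s x + a x • t x⟩ : TotalSpace F V)) S := fun x hx =>
  contMDiffWithinAt_add_smul (hs x hx) (ht x hx) (ha x hx)

/-- A lift of `f : N → B` to a vector bundle over `B`, with values in prescribed convex sets, exists
globally if it exists locally: this is the corresponding statement on sections, applied to the
pullback of the bundle along `f`. -/
theorem exists_contMDiff_lift_forall_mem_convex_of_local [FiniteDimensional ℝ EN]
    [IsManifold IN ∞ N] [T2Space N] [SigmaCompactSpace N] {f : N → B} (hf : ContMDiff IN IB ∞ f)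
    (t : ∀ x, Set (V (f x))) (ht : ∀ x, Convex ℝ (t x))
    (hloc : ∀ x₀, ∃ U ∈ 𝓝 x₀, ∃ s : ∀ x, V (f x),
      ContMDiffOn IN (IB.prod 𝓘(ℝ, F)) ∞ (fun x => (⟨f x, s x⟩ : TotalSpace F V)) U ∧
        ∀ x ∈ U, s x ∈ t x) :
    ∃ s : ∀ x, V (f x),
      ContMDiff IN (IB.prod 𝓘(ℝ, F)) ∞ (fun x => (⟨f x, s x⟩ : TotalSpace F V)) ∧
        ∀ x, s x ∈ t x := by
  let φ : C(N, B) := ⟨f, hf.continuous⟩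
  -- The fibres `V (f x)` carry the group structure of `V`, which the pullback `φ *ᵖ V` is not
  -- equipped with; topology and trivializations are those of the pullback.
  let W : N → Type _ := fun x => V (f x)
  let : ∀ x, AddCommGroup (W x) := fun x => ‹∀ b, AddCommGroup (V b)› (f x)
  let : ∀ x, Module ℝ (W x) := fun x => ‹∀ b, Module ℝ (V b)› (f x)
  let : ∀ x, TopologicalSpace (W x) := fun x => ‹∀ b, TopologicalSpace (V b)› (f x)
  let : TopologicalSpace (TotalSpace F W) := Pullback.TotalSpace.topologicalSpace F V φ
  let : FiberBundle F W := FiberBundle.pullback φ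
  have : VectorBundle ℝ F W := VectorBundle.pullback (𝕜 := ℝ) (E := V) φ
  obtain ⟨s, hs⟩ := exists_contMDiffSection_forall_mem_convex_of_local (n := (⊤ : ℕ∞)) IN
    (F_fiber := F) W t ht fun x₀ => by
      obtain ⟨U, hU, s, hs, hst⟩ := hloc x₀
      exact ⟨U, hU, s, fun x hx => contMDiffWithinAt_pullback_section hf.continuous (hs x hx), hst⟩
  exact ⟨s, contMDiff_of_pullback_section hf s.contMDiff, hs⟩

end VectorBundle

section PartialTangent

variable {EA : Type*} [NormedAddCommGroup EA] [NormedSpace ℝ EA]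
  {HA : Type*} [TopologicalSpace HA] {IA : ModelWithCorners ℝ EA HA}
  {A : Type*} [TopologicalSpace A] [ChartedSpace HA A] [IsManifold IA ∞ A]
  {EB : Type*} [NormedAddCommGroup EB] [NormedSpace ℝ EB]
  {HB : Type*} [TopologicalSpace HB] {IB : ModelWithCorners ℝ EB HB}
  {B : Type*} [TopologicalSpace B] [ChartedSpace HB B] [IsManifold IB ∞ B]
  {EC : Type*} [NormedAddCommGroup EC] [NormedSpace ℝ EC]
  {HC : Type*} [TopologicalSpace HC] {IC : ModelWithCorners ℝ EC HC}
  {C : Type*} [TopologicalSpace C] [ChartedSpace HC C] [IsManifold IC ∞ C]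
  {EN : Type*} [NormedAddCommGroup EN] [NormedSpace ℝ EN]
  {HN : Type*} [TopologicalSpace HN] {IN : ModelWithCorners ℝ EN HN}
  {N : Type*} [TopologicalSpace N] [ChartedSpace HN N]

/-- The partial derivative of a smooth `G : A × B → C` in the second variable depends smoothly on
the parameter in `A` and on the tangent vector to `B`. -/
theorem contMDiffOn_tangentMap_partial {G : A × B → C} (hG : ContMDiff (IA.prod IB) IC ∞ G)
    {f : N → A} {g : N → TangentBundle IB B} {S : Set N}
    (hf : ContMDiffOn IN IA ∞ f S) (hg : ContMDiffOn IN IB.tangent ∞ g S) :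
    ContMDiffOn IN IC.tangent ∞ (fun x => tangentMap IB IC (fun y => G (f x, y)) (g x)) S := by
  -- the partial derivative is the full derivative on tangent vectors of the form `(0, w)`
  have h0 : ContMDiffOn IN IA.tangent ∞
      (fun x => (⟨f x, 0⟩ : TangentBundle IA A)) S :=
    (contMDiff_zeroSection ℝ (TangentSpace IA : A → Type _)).comp_contMDiffOn hf
  have h1 : ContMDiffOn IN (IA.prod IB).tangent ∞ (fun x =>
      (⟨(f x, (g x).proj), ((0 : EA), (g x).2)⟩ : TangentBundle (IA.prod IB) (A × B))) S :=
    (contMDiff_equivTangentBundleProd_symm (I := IA) (I' := IB)).comp_contMDiffOn (h0.prodMk hg)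
  refine ((hG.contMDiff_tangentMap le_rfl).comp_contMDiffOn h1).congr fun x _ => ?_
  simp only [Function.comp, tangentMap]
  congr 1
  have hd : MDifferentiableAt (IA.prod IB) IC G (f x, (g x).proj) :=
    hG.mdifferentiableAt (by simp)
  have hc : mfderiv IB IC (fun y => G (f x, y)) (g x).proj =
      (mfderiv (IA.prod IB) IC G (f x, (g x).proj)).comp
        (mfderiv IB (IA.prod IB) (fun y => (f x, y)) (g x).proj) :=
    mfderiv_comp (g x).proj hd (mdifferentiableAt_const.prodMk mdifferentiableAt_id)
  rw [hc, mfderiv_prod_right]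
  rfl

end PartialTangent

/-! ### The time function and its differential -/

noncomputable section FibreBundle

variable {E : Type*} [NormedAddCommGroup E] [NormedSpace ℝ E]
  {Q : Type*} [TopologicalSpace Q] [ChartedSpace E Q]
  {F : Type*} [NormedAddCommGroup F] [NormedSpace ℝ F]
  {M : Type*} [TopologicalSpace M] [ChartedSpace F M] {pr : Q → ℝ}

theorem IsSmoothFibreBundle.contMDiff (h : IsSmoothFibreBundle (E := E) F M pr) :
    ContMDiff 𝓘(ℝ, E) 𝓘(ℝ, ℝ) ∞ pr := fun q => by
  obtain ⟨e, he, hs, -⟩ := h (pr q)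
  have hq : e.source ∈ 𝓝 q := e.open_source.mem_nhds (e.mem_source.2 he)
  refine ((contMDiffAt_fst (I := 𝓘(ℝ, ℝ)) (J := 𝓘(ℝ, F))).comp q
    (hs.contMDiffAt hq)).congr_of_eventuallyEq ?_
  filter_upwards [hq] with x hx using (e.coe_fst hx).symm

/-- The projection of a smooth fibre bundle is a submersion. -/
theorem IsSmoothFibreBundle.exists_mfderiv_eq_one (h : IsSmoothFibreBundle (E := E) F M pr)
    (q : Q) : ∃ w : TangentSpace 𝓘(ℝ, E) q, mfderiv 𝓘(ℝ, E) 𝓘(ℝ, ℝ) pr q w = (1 : ℝ) := by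
  obtain ⟨e, he, -, hs⟩ := h (pr q)
  have hq : q ∈ e.source := e.mem_source.2 he
  have hbase : e.baseSet ∈ 𝓝 (pr q) := e.open_baseSet.mem_nhds he
  -- the curve through `q` that is constant in the local trivialization
  set c : ℝ → Q := fun t => e.toOpenPartialHomeomorph.symm (t, (e q).2)
  have hcq : c (pr q) = q := by
    have : ((pr q, (e q).2) : ℝ × M) = e q := Prod.ext (e.coe_fst hq).symm rfl
    simp only [c, this]
    exact e.toOpenPartialHomeomorph.left_inv hq
  have hc : ContMDiffAt 𝓘(ℝ, ℝ) 𝓘(ℝ, E) ∞ c (pr q) := by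
    have ht : e.target ∈ 𝓝 ((pr q, (e q).2) : ℝ × M) :=
      e.open_target.mem_nhds (e.mem_target.2 he)
    exact (hs.contMDiffAt ht).comp (pr q) (contMDiffAt_id.prodMk contMDiffAt_const)
  have hd : MDifferentiableAt 𝓘(ℝ, ℝ) 𝓘(ℝ, E) c (pr q) := hc.mdifferentiableAt (by simp)
  have hp : MDifferentiableAt 𝓘(ℝ, E) 𝓘(ℝ, ℝ) pr (c (pr q)) :=
    h.contMDiff.mdifferentiableAt (by simp)
  have hid : pr ∘ c =ᶠ[𝓝 (pr q)] id := by
    filter_upwards [hbase] with t ht using e.proj_symm_apply (e.mem_target.2 ht)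
  have key : (mfderiv 𝓘(ℝ, E) 𝓘(ℝ, ℝ) pr (c (pr q))).comp (mfderiv 𝓘(ℝ, ℝ) 𝓘(ℝ, E) c (pr q)) =
      ContinuousLinearMap.id ℝ ℝ := by
    rw [← mfderiv_comp (pr q) hp hd, hid.mfderiv_eq]
    exact mfderiv_id
  refine hcq ▸ ⟨mfderiv 𝓘(ℝ, ℝ) 𝓘(ℝ, E) c (pr q) (1 : ℝ), ?_⟩
  exact congrArg (fun A : ℝ →L[ℝ] ℝ => A 1) key

/-- The one-form `dt` on `Q`, with values in `ℝ` rather than in the tangent spaces of `ℝ`. -/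
def dtime (pr : Q → ℝ) (q : Q) : TangentSpace 𝓘(ℝ, E) q →L[ℝ] ℝ :=
  mfderiv 𝓘(ℝ, E) 𝓘(ℝ, ℝ) pr q

end FibreBundle

/-! ### Curves and their tangent prolongations -/

section Curves

theorem exists_eqOn_add_const_of_hasDerivAt_one {f : ℝ → ℝ} {J : Set ℝ} (hJ : IsOpen J)
    (hJc : J.OrdConnected) (hf : ∀ t ∈ J, HasDerivAt f 1 t) : ∃ a, ∀ t ∈ J, f t = t + a := by
  have hd : ∀ t ∈ J, HasDerivAt (fun t => f t - t) 0 t := fun t ht =>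
    sub_self (1 : ℝ) ▸ (hf t ht).sub (hasDerivAt_id' t)
  obtain ⟨a, ha⟩ := hJ.exists_is_const_of_deriv_eq_zero hJc.isPreconnected
    (fun t ht => (hd t ht).differentiableAt.differentiableWithinAt) fun t ht => (hd t ht).deriv
  exact ⟨a, fun t ht => by linarith [ha t ht]⟩

theorem isMIntegralCurveOn_congr_field {H : Type*} [TopologicalSpace H] {E' : Type*}
    [NormedAddCommGroup E'] [NormedSpace ℝ E'] {I : ModelWithCorners ℝ E' H}
    {M : Type*} [TopologicalSpace M] [ChartedSpace H M] {γ : ℝ → M}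
    {v w : ∀ x : M, TangentSpace I x} {J : Set ℝ} (h : ∀ t ∈ J, v (γ t) = w (γ t)) :
    IsMIntegralCurveOn γ v J ↔ IsMIntegralCurveOn γ w J :=
  forall₂_congr fun t ht => by rw [h t ht]

variable {E : Type*} [NormedAddCommGroup E] [NormedSpace ℝ E]
  {Q : Type*} [TopologicalSpace Q] [ChartedSpace E Q] {pr : Q → ℝ}

/-- Along a curve `c`, the function `ṫ` on the prolongation is the derivative of `pr ∘ c`. -/
theorem hasDerivAt_comp_curve (hpr : ContMDiff 𝓘(ℝ, E) 𝓘(ℝ, ℝ) ∞ pr) {c : ℝ → Q} {τ : ℝ}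
    (hc : MDifferentiableAt 𝓘(ℝ, ℝ) 𝓘(ℝ, E) c τ) :
    HasDerivAt (pr ∘ c) (tdot pr (prolong E c τ)) τ := by
  have hp : MDifferentiableAt 𝓘(ℝ, E) 𝓘(ℝ, ℝ) pr (c τ) := hpr.mdifferentiableAt (by simp)
  -- the tangent spaces of `ℝ` are replaced by `ℝ` itself
  let L : ℝ →L[ℝ] ℝ :=
    (mfderiv 𝓘(ℝ, E) 𝓘(ℝ, ℝ) pr (c τ)).comp (mfderiv 𝓘(ℝ, ℝ) 𝓘(ℝ, E) c τ)
  have h : HasFDerivAt (pr ∘ c) L τ := (hp.hasMFDerivAt.comp τ hc.hasMFDerivAt).hasFDerivAt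
  exact h.hasDerivAt

theorem prolong_comp_sub (c : ℝ → Q) (a : ℝ) :
    prolong E (fun t => c (t - a)) = prolong E c ∘ (· - a) := by
  have hshift : ∀ (b t : ℝ), HasMFDerivAt 𝓘(ℝ, ℝ) 𝓘(ℝ, ℝ) (fun t : ℝ => t - b) t
      (ContinuousLinearMap.id ℝ ℝ) := fun b t =>
    ((hasFDerivAt_id t).sub_const b).hasMFDerivAt
  funext t
  refine congrArg (fun A : ℝ →L[ℝ] E => (⟨c (t - a), A 1⟩ : TangentBundle 𝓘(ℝ, E) Q)) ?_
  by_cases hc : MDifferentiableAt 𝓘(ℝ, ℝ) 𝓘(ℝ, E) c (t - a)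
  · exact (hc.hasMFDerivAt.comp t (hshift a t)).mfderiv.trans (ContinuousLinearMap.comp_id _)
  · -- both derivatives take the default value `0`
    have hc' : ¬ MDifferentiableAt 𝓘(ℝ, ℝ) 𝓘(ℝ, E) (fun t => c (t - a)) t := fun h => hc (by
      have h0 : t - a - -a = t := by ring
      have := (h0.symm ▸ h : MDifferentiableAt 𝓘(ℝ, ℝ) 𝓘(ℝ, E) (fun t => c (t - a)) _).comp (t - a)
        (hshift (-a) (t - a)).mdifferentiableAt
      simpa [Function.comp_def] using this)
    exact (mfderiv_zero_of_not_mdifferentiableAt hc').trans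
      (mfderiv_zero_of_not_mdifferentiableAt hc).symm

end Curves

noncomputable section Connections

variable {E : Type*} [NormedAddCommGroup E] [NormedSpace ℝ E]
  {Q : Type*} [TopologicalSpace Q] [ChartedSpace E Q] [IsManifold 𝓘(ℝ, E) ∞ Q] {pr : Q → ℝ}

/-! ### Reference frames -/

theorem contMDiff_tdot (hpr : ContMDiff 𝓘(ℝ, E) 𝓘(ℝ, ℝ) ∞ pr) :
    ContMDiff 𝓘(ℝ, E).tangent 𝓘(ℝ, ℝ) ∞ (tdot (E := E) pr) :=
  (contMDiff_snd_tangentBundle_modelSpace ℝ 𝓘(ℝ, ℝ)).comp (hpr.contMDiff_tangentMap le_rfl)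

/-- A smooth vector field on `Q` that projects onto `∂_t`, that is, a reference frame. -/
structure ReferenceFrame (pr : Q → ℝ) where
  toFun : ∀ q : Q, TangentSpace 𝓘(ℝ, E) q
  smooth : ContMDiff 𝓘(ℝ, E) 𝓘(ℝ, E).tangent ∞ (fun q => (⟨q, toFun q⟩ : TangentBundle 𝓘(ℝ, E) Q))
  mfderiv_eq_one : ∀ q, mfderiv 𝓘(ℝ, E) 𝓘(ℝ, ℝ) pr q (toFun q) = (1 : ℝ)

/-- A submersion to `ℝ` admits a reference frame: the condition `dt(X) = 1` is affine, so local
solutions can be glued by a partition of unity. -/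
theorem exists_referenceFrame [FiniteDimensional ℝ E] [T2Space Q] [SecondCountableTopology Q]
    (hpr : ContMDiff 𝓘(ℝ, E) 𝓘(ℝ, ℝ) ∞ pr)
    (h : ∀ q : Q, ∃ w : TangentSpace 𝓘(ℝ, E) q, mfderiv 𝓘(ℝ, E) 𝓘(ℝ, ℝ) pr q w = (1 : ℝ)) :
    Nonempty (ReferenceFrame (E := E) pr) := by
  have : LocallyCompactSpace Q := ChartedSpace.locallyCompactSpace E Q
  obtain ⟨X, hX⟩ := exists_contMDiffSection_forall_mem_convex_of_local (n := (⊤ : ℕ∞)) 𝓘(ℝ, E)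
    (F_fiber := E) (TangentSpace 𝓘(ℝ, E) : Q → Type _)
    (fun q => {w | mfderiv 𝓘(ℝ, E) 𝓘(ℝ, ℝ) pr q w = (1 : ℝ)})
    (fun q w hw w' hw' a b _ _ hab => by
      change mfderiv 𝓘(ℝ, E) 𝓘(ℝ, ℝ) pr q (a • w + b • w') = (1 : ℝ)
      rw [map_add, map_smul, map_smul, hw, hw']
      exact (by simpa using hab : a • (1 : ℝ) + b • (1 : ℝ) = 1))
    fun q₀ => by
      obtain ⟨w, hw⟩ := h q₀
      obtain ⟨U, hU, hY⟩ := FiberBundle.exists_contMDiffOn_extend (k := ∞) 𝓘(ℝ, E) E w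
      -- extend `w` to a local vector field, and normalize it where `dt` does not vanish on it
      set Y : ∀ q : Q, TangentSpace 𝓘(ℝ, E) q := FiberBundle.extend E w
      have hf : ContMDiffOn 𝓘(ℝ, E) 𝓘(ℝ, ℝ) ∞ (fun q => tdot (E := E) pr ⟨q, Y q⟩) U :=
        (contMDiff_tdot hpr).comp_contMDiffOn hY
      have hY0 : tdot (E := E) pr ⟨q₀, Y q₀⟩ = 1 := by
        rw [show Y q₀ = w by simp [Y]]
        exact hw
      have hne : ∀ᶠ q in 𝓝 q₀, tdot (E := E) pr ⟨q, Y q⟩ ≠ 0 :=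
        (hf.continuousOn.continuousAt hU).eventually_ne (by rw [hY0]; exact one_ne_zero)
      refine ⟨_, inter_mem hU hne, fun q => (tdot (E := E) pr ⟨q, Y q⟩)⁻¹ • Y q, ?_, ?_⟩
      · refine ContMDiffOn.smul_section ?_ (hY.mono inter_subset_left)
        exact (hf.mono inter_subset_left).inv₀ fun q hq => hq.2
      · rintro q ⟨-, hq⟩
        refine (map_smul (mfderiv 𝓘(ℝ, E) 𝓘(ℝ, ℝ) pr q) _ _).trans ?_
        exact inv_mul_cancel₀ hq
  exact ⟨⟨X, X.contMDiff, hX⟩⟩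

namespace ReferenceFrame

/-- Translation by `s X` in the fibres of `TQ`, as a map `(s, v) ↦ v + s X` jointly smooth in `s` and
`v`. -/
def translate (X : ReferenceFrame (E := E) pr) (p : ℝ × TangentBundle 𝓘(ℝ, E) Q) :
    TangentBundle 𝓘(ℝ, E) Q :=
  ⟨p.2.proj, p.2.2 + p.1 • X.toFun p.2.proj⟩

variable (X : ReferenceFrame (E := E) pr)

theorem contMDiff_translate :
    ContMDiff (𝓘(ℝ, ℝ).prod 𝓘(ℝ, E).tangent) 𝓘(ℝ, E).tangent ∞ X.translate := by
  rw [← contMDiffOn_univ]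
  refine contMDiffOn_add_smul contMDiff_snd.contMDiffOn ?_ contMDiff_fst.contMDiffOn
  exact (X.smooth.comp ((contMDiff_proj (TangentSpace 𝓘(ℝ, E) : Q → Type _)).comp
    contMDiff_snd)).contMDiffOn

theorem mdifferentiableAt_translate (s : ℝ) (v : TangentBundle 𝓘(ℝ, E) Q) :
    MDifferentiableAt 𝓘(ℝ, E).tangent 𝓘(ℝ, E).tangent (fun w => X.translate (s, w)) v :=
  (X.contMDiff_translate.comp (contMDiff_const.prodMk contMDiff_id)).mdifferentiableAt (by simp)

theorem tdot_translate (s : ℝ) (v : TangentBundle 𝓘(ℝ, E) Q) :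
    tdot pr (X.translate (s, v)) = tdot pr v + s := by
  change mfderiv 𝓘(ℝ, E) 𝓘(ℝ, ℝ) pr v.proj (v.2 + s • X.toFun v.proj) = _
  rw [map_add, map_smul, X.mfderiv_eq_one]
  exact congrArg (tdot pr v + ·) (mul_one s)

theorem translate_translate (r s : ℝ) (v : TangentBundle 𝓘(ℝ, E) Q) :
    X.translate (r, X.translate (s, v)) = X.translate (s + r, v) := by
  simp only [translate, add_smul]
  exact congrArg (TotalSpace.mk v.proj) (add_assoc _ _ _)

theorem translate_zero (v : TangentBundle 𝓘(ℝ, E) Q) : X.translate (0, v) = v := by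
  simp only [translate, zero_smul, add_zero]

/-- The projection `v ↦ v + (1 - ṫ(v)) X` of `TQ` onto `J¹Q` along the reference frame. -/
def toJet (v : TangentBundle 𝓘(ℝ, E) Q) : TangentBundle 𝓘(ℝ, E) Q :=
  X.translate (1 - tdot pr v, v)

theorem toJet_mem (v : TangentBundle 𝓘(ℝ, E) Q) : X.toJet v ∈ jetSpace pr := by
  change tdot pr (X.translate _) = 1
  rw [X.tdot_translate]
  ring

theorem toJet_of_mem {v : TangentBundle 𝓘(ℝ, E) Q} (hv : v ∈ jetSpace pr) : X.toJet v = v := by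
  have : tdot pr v = 1 := hv
  rw [toJet, this, sub_self, translate_zero]

theorem translate_toJet (v : TangentBundle 𝓘(ℝ, E) Q) :
    X.translate (tdot pr v - 1, X.toJet v) = v := by
  rw [toJet, translate_translate, sub_add_sub_cancel, sub_self, translate_zero]

theorem contMDiff_toJet (hpr : ContMDiff 𝓘(ℝ, E) 𝓘(ℝ, ℝ) ∞ pr) :
    ContMDiff 𝓘(ℝ, E).tangent 𝓘(ℝ, E).tangent ∞ X.toJet :=
  X.contMDiff_translate.comp ((contMDiff_const.sub (contMDiff_tdot hpr)).prodMk contMDiff_id)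

end ReferenceFrame

/-- All tangent spaces of `TQ` are the same type `E × E`, so a tangent vector can be moved along an
equality of base points without a cast. -/
theorem totalSpace_mk_eq_of_eq {v w : TangentBundle 𝓘(ℝ, E) Q} (h : v = w) (z : E × E) :
    (⟨v, z⟩ : TangentBundle 𝓘(ℝ, E).tangent (TangentBundle 𝓘(ℝ, E) Q)) = ⟨w, z⟩ := by
  subst h; rfl

/-! ### Extension of dynamic connections to the tangent bundle -/

section Smoothness

variable {E' : Type*} [NormedAddCommGroup E'] [NormedSpace ℝ E']
  {H' : Type*} [TopologicalSpace H'] {I' : ModelWithCorners ℝ E' H'}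
  {N : Type*} [TopologicalSpace N] [ChartedSpace H' N]
  {b : N → Q} {s t : ∀ x, TangentSpace 𝓘(ℝ, E) (b x)} {S : Set N}

theorem DynamicConnection.contMDiffOn_apply (γ : DynamicConnection (E := E) pr)
    (hs : ContMDiffOn I' 𝓘(ℝ, E).tangent ∞
      (fun x => (⟨b x, s x⟩ : TangentBundle 𝓘(ℝ, E) Q)) S)
    (ht : ContMDiffOn I' 𝓘(ℝ, E).tangent ∞
      (fun x => (⟨b x, t x⟩ : TangentBundle 𝓘(ℝ, E) Q)) S)
    (hJ : ∀ x ∈ S, (⟨b x, s x⟩ : TangentBundle 𝓘(ℝ, E) Q) ∈ jetSpace pr) :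
    ContMDiffOn I' 𝓘(ℝ, E).tangent.tangent ∞
      (fun x => (⟨⟨b x, s x⟩, γ.toFun ⟨b x, s x⟩ (t x)⟩ :
        TangentBundle 𝓘(ℝ, E).tangent (TangentBundle 𝓘(ℝ, E) Q))) S :=
  γ.smooth.comp (contMDiffOn_prod_mk hs ht) hJ

theorem TangentConnection.contMDiffOn_apply (K : TangentConnection E Q)
    (hs : ContMDiffOn I' 𝓘(ℝ, E).tangent ∞
      (fun x => (⟨b x, s x⟩ : TangentBundle 𝓘(ℝ, E) Q)) S)
    (ht : ContMDiffOn I' 𝓘(ℝ, E).tangent ∞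
      (fun x => (⟨b x, t x⟩ : TangentBundle 𝓘(ℝ, E) Q)) S) :
    ContMDiffOn I' 𝓘(ℝ, E).tangent.tangent ∞
      (fun x => (⟨⟨b x, s x⟩, K.toFun ⟨b x, s x⟩ (t x)⟩ :
        TangentBundle 𝓘(ℝ, E).tangent (TangentBundle 𝓘(ℝ, E) Q))) S :=
  K.smooth.comp_contMDiffOn (contMDiffOn_prod_mk hs ht)

end Smoothness

section Composition

variable {E' : Type*} [NormedAddCommGroup E'] [NormedSpace ℝ E']
  {H' : Type*} [TopologicalSpace H'] {I' : ModelWithCorners ℝ E' H'}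
  {N : Type*} [TopologicalSpace N] [ChartedSpace H' N]
  {G : N → TangentBundle 𝓘(ℝ, E) Q} {x : N} {v : TangentBundle 𝓘(ℝ, E) Q}

/-- The chain rule for the projection `TQ → Q`, with the point `v` at which `dproj` is taken equal to
`G x` only propositionally. -/
theorem dproj_mfderiv (hG : MDifferentiableAt I' 𝓘(ℝ, E).tangent G x) (hv : G x = v)
    (z : TangentSpace I' x) :
    dproj v (mfderiv I' 𝓘(ℝ, E).tangent G x z : E × E) =
      (mfderiv I' 𝓘(ℝ, E) (fun y => (G y).proj) x z : E) := by
  subst hv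
  have hp : MDifferentiableAt 𝓘(ℝ, E).tangent 𝓘(ℝ, E)
      (fun w : TangentBundle 𝓘(ℝ, E) Q => w.proj) (G x) :=
    (contMDiff_proj (F := E) (IB := 𝓘(ℝ, E)) (n := ∞)
      (TangentSpace 𝓘(ℝ, E) : Q → Type _)).mdifferentiableAt (by simp)
  exact (congrArg (fun A : E' →L[ℝ] E => A z) (mfderiv_comp x hp hG)).symm

/-- The chain rule for `ṫ`, with the point `v` at which `dtdot` is taken equal to `G x` only
propositionally. -/
theorem dtdot_mfderiv (hpr : ContMDiff 𝓘(ℝ, E) 𝓘(ℝ, ℝ) ∞ pr)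
    (hG : MDifferentiableAt I' 𝓘(ℝ, E).tangent G x) (hv : G x = v) (z : TangentSpace I' x) :
    dtdot pr v (mfderiv I' 𝓘(ℝ, E).tangent G x z : E × E) =
      (mfderiv I' 𝓘(ℝ, ℝ) (fun y => tdot pr (G y)) x z : ℝ) := by
  subst hv
  have hp : MDifferentiableAt 𝓘(ℝ, E).tangent 𝓘(ℝ, ℝ) (tdot (E := E) pr) (G x) :=
    (contMDiff_tdot hpr).mdifferentiableAt (by simp)
  exact (congrArg (fun A : E' →L[ℝ] ℝ => A z) (mfderiv_comp x hp hG)).symm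

end Composition

/-- The extension to `TQ` of a dynamic connection `γ` along a reference frame `X`: the lift of `u` at
`v` is the lift by `γ` at `X.toJet v ∈ J¹Q`, carried to `v` by the tangent map of the translation
that moves `X.toJet v` to `v`. The amount `ṫ(v) - 1` of this translation is kept fixed when
differentiating. -/
def DynamicConnection.extend (X : ReferenceFrame (E := E) pr)
    (hpr : ContMDiff 𝓘(ℝ, E) 𝓘(ℝ, ℝ) ∞ pr) (γ : DynamicConnection (E := E) pr) :
    TangentConnection E Q where
  toFun v := (mfderiv 𝓘(ℝ, E).tangent 𝓘(ℝ, E).tangent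
    (fun w => X.translate (tdot pr v - 1, w)) (X.toJet v)).comp (γ.toFun (X.toJet v))
  smooth := by
    have h1 := contMDiff_prod_fst (n := ∞) (IB := 𝓘(ℝ, E)) (F := E) (F₂ := E)
      (V := (TangentSpace 𝓘(ℝ, E) : Q → Type _)) (V₂ := (TangentSpace 𝓘(ℝ, E) : Q → Type _))
    have h2 := contMDiff_prod_snd (n := ∞) (IB := 𝓘(ℝ, E)) (F := E) (F₂ := E)
      (V := (TangentSpace 𝓘(ℝ, E) : Q → Type _)) (V₂ := (TangentSpace 𝓘(ℝ, E) : Q → Type _))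
    have h4 := γ.contMDiffOn_apply (S := univ) (N := TotalSpace (E × E)
        ((TangentSpace 𝓘(ℝ, E) : Q → Type _) ×ᵇ (TangentSpace 𝓘(ℝ, E) : Q → Type _)))
      (b := fun p => p.1) (s := fun p => (X.toJet ⟨p.1, p.2.1⟩).2) (t := fun p => p.2.2)
      ((X.contMDiff_toJet hpr).comp h1).contMDiffOn h2.contMDiffOn fun p _ =>
        X.toJet_mem (⟨p.1, p.2.1⟩ : TangentBundle 𝓘(ℝ, E) Q)
    have h5 := contMDiffOn_tangentMap_partial X.contMDiff_translate (S := univ)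
      (((contMDiff_tdot hpr).comp h1).sub (contMDiff_const (c := (1 : ℝ)))).contMDiffOn h4
    rw [contMDiffOn_univ] at h5
    exact h5.congr fun p => totalSpace_mk_eq_of_eq (X.translate_toJet _).symm _
  horizontal v u := by
    exact (dproj_mfderiv (X.mdifferentiableAt_translate _ _) (X.translate_toJet v) _).trans
      (γ.horizontal _ (X.toJet_mem v) u)

theorem DynamicConnection.extend_timeComponentsVanish (X : ReferenceFrame (E := E) pr)
    (hpr : ContMDiff 𝓘(ℝ, E) 𝓘(ℝ, ℝ) ∞ pr) (γ : DynamicConnection (E := E) pr) :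
    (γ.extend X hpr).TimeComponentsVanish pr := fun v u => by
  have ht : MDifferentiableAt 𝓘(ℝ, E).tangent 𝓘(ℝ, ℝ) (tdot (E := E) pr) (X.toJet v) :=
    (contMDiff_tdot hpr).mdifferentiableAt (by simp)
  refine (dtdot_mfderiv hpr (X.mdifferentiableAt_translate _ _) (X.translate_toJet v) _).trans ?_
  have hadd : (fun w => tdot pr (X.translate (tdot pr v - 1, w))) =
      tdot pr + fun _ => tdot pr v - 1 := funext fun w => X.tdot_translate _ w
  rw [hadd, ← γ.tangent _ (X.toJet_mem v) u]
  have key : (mfderiv 𝓘(ℝ, E).tangent 𝓘(ℝ, ℝ)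
      (tdot (E := E) pr + fun _ => tdot pr v - 1) (X.toJet v) : E × E →L[ℝ] ℝ) =
      mfderiv 𝓘(ℝ, E).tangent 𝓘(ℝ, ℝ) (tdot pr) (X.toJet v) :=
    (mfderiv_add ht (mdifferentiableAt_const (c := tdot pr v - 1))).trans
      ((congrArg (fun A : E × E →L[ℝ] ℝ => _ + A) mfderiv_const).trans (add_zero _))
  exact congrArg (fun A : E × E →L[ℝ] ℝ => A _) key

theorem DynamicConnection.extend_extends (X : ReferenceFrame (E := E) pr)
    (hpr : ContMDiff 𝓘(ℝ, E) 𝓘(ℝ, ℝ) ∞ pr) (γ : DynamicConnection (E := E) pr) :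
    (γ.extend X hpr).Extends γ := fun v hv u => by
  have h1 : tdot pr v = 1 := hv
  have h2 : (fun w => X.translate (tdot pr v - 1, w)) = id := by
    funext w
    rw [h1, sub_self, X.translate_zero, id]
  simp only [DynamicConnection.extend]
  rw [h2, mfderiv_id]
  have key : ∀ w : TangentBundle 𝓘(ℝ, E) Q, w = v → ∀ u : E,
    (γ.toFun w u : E × E) = γ.toFun v u := by rintro _ rfl _; rfl
  exact key _ (X.toJet_of_mem hv) u

/-! ### Existence of connections -/

/-- Every `v ∈ TQ` extends to a vector field `V(v, ·)` on `Q` with constant `dt(V(v, ·)) = ṫ(v)`,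
smoothly in `v`. -/
theorem exists_fibre_extension [FiniteDimensional ℝ E] [T2Space Q] [SecondCountableTopology Q]
    (hpr : ContMDiff 𝓘(ℝ, E) 𝓘(ℝ, ℝ) ∞ pr) (X : ReferenceFrame (E := E) pr) :
    ∃ V : TangentBundle 𝓘(ℝ, E) Q × Q → TangentBundle 𝓘(ℝ, E) Q,
      ContMDiff (𝓘(ℝ, E).tangent.prod 𝓘(ℝ, E)) 𝓘(ℝ, E).tangent ∞ V ∧
      (∀ p, (V p).proj = p.2) ∧ (∀ p, tdot pr (V p) = tdot pr p.1) ∧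
      ∀ v, V (v, v.proj) = v := by
  have : LocallyCompactSpace Q := ChartedSpace.locallyCompactSpace E Q
  have : T2Space (TangentBundle 𝓘(ℝ, E) Q) := t2Space_totalSpace E (TangentSpace 𝓘(ℝ, E))
  have : SecondCountableTopology E := secondCountable_of_proper
  have : SecondCountableTopology (TangentBundle 𝓘(ℝ, E) Q) :=
    secondCountableTopology_totalSpace E (TangentSpace 𝓘(ℝ, E))
  have : LocallyCompactSpace (TangentBundle 𝓘(ℝ, E) Q) :=
    Manifold.locallyCompact_of_finiteDimensional 𝓘(ℝ, E).tangent
  -- Near a given point, a family that need not preserve `ṫ`: near the diagonal it is constant in a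
  -- trivialization of `TQ`, elsewhere it is zero.
  have local_ext : ∀ p₀ : TangentBundle 𝓘(ℝ, E) Q × Q, ∃ U ∈ 𝓝 p₀,
      ∃ W : ∀ p : TangentBundle 𝓘(ℝ, E) Q × Q, TangentSpace 𝓘(ℝ, E) p.2,
        ContMDiffOn (𝓘(ℝ, E).tangent.prod 𝓘(ℝ, E)) 𝓘(ℝ, E).tangent ∞
          (fun p => (⟨p.2, W p⟩ : TangentBundle 𝓘(ℝ, E) Q)) U ∧
        ∀ p ∈ U, p.2 = p.1.proj → (⟨p.2, W p⟩ : TangentBundle 𝓘(ℝ, E) Q) = p.1 := by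
    rintro ⟨v₀, q₀⟩
    by_cases h : q₀ = v₀.proj
    · set e := trivializationAt E (TangentSpace 𝓘(ℝ, E) : Q → Type _) q₀
      have hb : q₀ ∈ e.baseSet := mem_baseSet_trivializationAt E _ q₀
      refine ⟨e.source ×ˢ e.baseSet, prod_mem_nhds
        (e.open_source.mem_nhds (e.mem_source.2 (h ▸ hb))) (e.open_baseSet.mem_nhds hb),
        fun p => e.symm p.2 (e p.1).2, ?_, ?_⟩
      · have h1 : ContMDiffOn (𝓘(ℝ, E).tangent.prod 𝓘(ℝ, E)) (𝓘(ℝ, E).prod 𝓘(ℝ, E)) ∞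
            (fun p : TangentBundle 𝓘(ℝ, E) Q × Q => (p.2, (e p.1).2)) (e.source ×ˢ e.baseSet) :=
          contMDiff_snd.contMDiffOn.prodMk (contMDiff_snd.comp_contMDiffOn
            ((e.contMDiffOn (n := ∞)).comp contMDiff_fst.contMDiffOn fun p hp => hp.1))
        refine ((e.contMDiffOn_symm (n := ∞)).comp h1
          fun p hp => e.mem_target.2 hp.2).congr fun p hp => ?_
        exact e.mk_symm hp.2 _
      · rintro ⟨v, q⟩ ⟨hv, hq⟩ (rfl : q = v.proj)
        exact (e.mk_symm hq _).trans (e.symm_apply_mk_proj hv)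
    · refine ⟨{p | p.2 ≠ p.1.proj}, ?_, fun p => 0, ?_, fun p hp hp' => absurd hp' hp⟩
      · exact (isOpen_ne_fun continuous_snd
          ((FiberBundle.continuous_proj E (TangentSpace 𝓘(ℝ, E) : Q → Type _)).comp
            continuous_fst)).mem_nhds h
      · exact ((contMDiff_zeroSection ℝ (TangentSpace 𝓘(ℝ, E) : Q → Type _)).comp
          contMDiff_snd).contMDiffOn
  obtain ⟨s, hs, hst⟩ := exists_contMDiff_lift_forall_mem_convex_of_local
    (IN := 𝓘(ℝ, E).tangent.prod 𝓘(ℝ, E)) (N := TangentBundle 𝓘(ℝ, E) Q × Q) (F := E)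
    (V := (TangentSpace 𝓘(ℝ, E) : Q → Type _)) (contMDiff_snd (I := 𝓘(ℝ, E).tangent))
    (fun p => {w | tdot pr (⟨p.2, w⟩ : TangentBundle 𝓘(ℝ, E) Q) = tdot pr p.1 ∧
      (p.2 = p.1.proj → (⟨p.2, w⟩ : TangentBundle 𝓘(ℝ, E) Q) = p.1)})
    (by
      rintro ⟨v, q⟩ w ⟨hw, hw₁⟩ w' ⟨hw', hw₁'⟩ a b - - hab
      refine ⟨?_, fun h => ?_⟩
      · change mfderiv 𝓘(ℝ, E) 𝓘(ℝ, ℝ) pr q (a • w + b • w') = _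
        rw [map_add, map_smul, map_smul]
        refine (congrArg₂ (fun x y : ℝ => a • x + b • y) hw hw').trans ?_
        rw [← add_smul, hab, one_smul]
      · have e1 := hw₁ h
        obtain rfl : w = w' := TotalSpace.mk_inj.1 (e1.trans (hw₁' h).symm)
        rw [← e1, Convex.combo_self hab])
    (by
      intro p₀
      obtain ⟨U, hU, W, hW, hWd⟩ := local_ext p₀
      -- the correction along `X` gives `ṫ` the right value and vanishes on the diagonal
      refine ⟨U, hU, fun p => W p +
        (tdot pr p.1 - tdot pr (⟨p.2, W p⟩ : TangentBundle 𝓘(ℝ, E) Q)) • X.toFun p.2,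
        ?_, fun p hp => ⟨?_, fun h => ?_⟩⟩
      · refine contMDiffOn_add_smul hW (X.smooth.comp contMDiff_snd).contMDiffOn ?_
        exact ((contMDiff_tdot hpr).comp contMDiff_fst).contMDiffOn.sub
          ((contMDiff_tdot hpr).comp_contMDiffOn hW)
      · exact (X.tdot_translate _ (⟨p.2, W p⟩ : TangentBundle 𝓘(ℝ, E) Q)).trans
          (add_sub_cancel _ _)
      · change X.translate (tdot pr p.1 - tdot pr (⟨p.2, W p⟩ : TangentBundle 𝓘(ℝ, E) Q),
          (⟨p.2, W p⟩ : TangentBundle 𝓘(ℝ, E) Q)) = p.1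
        rw [hWd p hp h, sub_self, X.translate_zero])
  exact ⟨fun p => ⟨p.2, s p⟩, hs, fun p => rfl, fun p => (hst p).1,
    fun v => (hst (v, v.proj)).2 rfl⟩

/-- The derivatives at `π(v)` of vector fields `V(v, ·)` extending `v` form a connection on `TQ`, and
`K⁰_λ = 0` if `dt(V(v, ·))` is constant. -/
theorem exists_tangentConnection [FiniteDimensional ℝ E] [T2Space Q] [SecondCountableTopology Q]
    (hpr : ContMDiff 𝓘(ℝ, E) 𝓘(ℝ, ℝ) ∞ pr) (X : ReferenceFrame (E := E) pr) :
    ∃ K : TangentConnection E Q, K.TimeComponentsVanish pr := by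
  obtain ⟨V, hV, hV_proj, hV_tdot, hV_diag⟩ := exists_fibre_extension hpr X
  have hd : ∀ v : TangentBundle 𝓘(ℝ, E) Q, MDifferentiableAt 𝓘(ℝ, E) 𝓘(ℝ, E).tangent
      (fun q => V (v, q)) v.proj := fun v =>
    (hV.comp (contMDiff_const.prodMk contMDiff_id)).mdifferentiableAt (by simp)
  refine ⟨⟨fun v => mfderiv 𝓘(ℝ, E) 𝓘(ℝ, E).tangent (fun q => V (v, q)) v.proj, ?_, ?_⟩, ?_⟩
  · have h1 := contMDiff_prod_fst (n := ∞) (IB := 𝓘(ℝ, E)) (F := E) (F₂ := E)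
      (V := (TangentSpace 𝓘(ℝ, E) : Q → Type _)) (V₂ := (TangentSpace 𝓘(ℝ, E) : Q → Type _))
    have h2 := contMDiff_prod_snd (n := ∞) (IB := 𝓘(ℝ, E)) (F := E) (F₂ := E)
      (V := (TangentSpace 𝓘(ℝ, E) : Q → Type _)) (V₂ := (TangentSpace 𝓘(ℝ, E) : Q → Type _))
    have h3 := contMDiffOn_tangentMap_partial hV (S := univ) h1.contMDiffOn h2.contMDiffOn
    rw [contMDiffOn_univ] at h3
    exact h3.congr fun p => totalSpace_mk_eq_of_eq (hV_diag _).symm _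
  · intro v u
    refine (dproj_mfderiv (hd v) (hV_diag v) u).trans ?_
    rw [show (fun q => (V (v, q)).proj) = id from funext fun q => hV_proj (v, q)]
    exact congrArg (fun A : E →L[ℝ] E => A u) mfderiv_id
  · intro v u
    refine (dtdot_mfderiv hpr (hd v) (hV_diag v) u).trans ?_
    rw [show (fun q => tdot pr (V (v, q))) = fun _ => tdot pr v from
      funext fun q => hV_tdot (v, q)]
    exact congrArg (fun A : E →L[ℝ] ℝ => A u) mfderiv_const

/-- The dynamic connection `γ(v, u) = K(v, u) + dt(u) (ξ(v) - K(v, v))`, a modification of the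
restriction of `K` to `J¹Q` that yields the dynamic equation `ξ`. -/
def TangentConnection.toDynamicConnection (K : TangentConnection E Q)
    (hpr : ContMDiff 𝓘(ℝ, E) 𝓘(ℝ, ℝ) ∞ pr) (hK : K.TimeComponentsVanish pr)
    (ξ : DynamicEquation (E := E) pr) : DynamicConnection (E := E) pr where
  toFun v := K.toFun v + (dtime pr v.proj).smulRight (ξ.toFun v - K.toFun v v.2)
  smooth := by
    have h1 := contMDiff_prod_fst (n := ∞) (IB := 𝓘(ℝ, E)) (F := E) (F₂ := E)
      (V := (TangentSpace 𝓘(ℝ, E) : Q → Type _)) (V₂ := (TangentSpace 𝓘(ℝ, E) : Q → Type _))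
    have h2 := contMDiff_prod_snd (n := ∞) (IB := 𝓘(ℝ, E)) (F := E) (F₂ := E)
      (V := (TangentSpace 𝓘(ℝ, E) : Q → Type _)) (V₂ := (TangentSpace 𝓘(ℝ, E) : Q → Type _))
    have hξ := ξ.smooth.comp h1.contMDiffOn (subset_refl _)
    have hdiff := contMDiffOn_add_smul hξ
      (K.contMDiffOn_apply h1.contMDiffOn h1.contMDiffOn) (contMDiffOn_const (c := (-1 : ℝ)))
    have hsum := contMDiffOn_add_smul K.smooth.contMDiffOn hdiff
      ((contMDiff_tdot hpr).comp h2).contMDiffOn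
    refine hsum.congr fun p hp => ?_
    refine congrArg (TotalSpace.mk _) ?_
    simp only [add_apply, ContinuousLinearMap.smulRight_apply, neg_smul,
      one_smul, sub_eq_add_neg]
    rfl
  tangent v hv u := by
    have h1 : dtdot pr v (ξ.toFun v - K.toFun v v.2) = 0 := by
      rw [map_sub, ξ.tangent v hv, hK, sub_zero]
    simp only [add_apply, ContinuousLinearMap.smulRight_apply]
    rw [map_add, map_smul, h1, hK, smul_zero, add_zero]
  horizontal v hv u := by
    have h1 : dproj v (ξ.toFun v - K.toFun v v.2) = 0 := by
      rw [map_sub, ξ.holonomic v hv, K.horizontal, sub_self]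
    simp only [add_apply, ContinuousLinearMap.smulRight_apply]
    rw [map_add, map_smul, h1, K.horizontal, smul_zero, add_zero]

theorem TangentConnection.toDynamicConnection_yields (K : TangentConnection E Q)
    (hpr : ContMDiff 𝓘(ℝ, E) 𝓘(ℝ, ℝ) ∞ pr) (hK : K.TimeComponentsVanish pr)
    (ξ : DynamicEquation (E := E) pr) : (K.toDynamicConnection hpr hK ξ).Yields ξ := fun v hv => by
  have h1 : dtime pr v.proj v.2 = 1 := hv
  change K.toFun v v.2 + dtime pr v.proj v.2 • (ξ.toFun v - K.toFun v v.2) = _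
  rw [h1, one_smul, add_sub_cancel]

/-! ### Solutions and geodesics -/

variable {ξ : DynamicEquation (E := E) pr} {K : TangentConnection E Q} {c : ℝ → Q} {J : Set ℝ}

theorem isSolutionOn_iff (hpr : ContMDiff 𝓘(ℝ, E) 𝓘(ℝ, ℝ) ∞ pr)
    (hξ : ∀ v ∈ jetSpace (E := E) pr, ξ.toFun v = K.geodesicField v) (hJ : IsOpen J) :
    ξ.IsSolutionOn c J ↔ K.IsUnitTimeGeodesicOn pr c J ∧ ∀ t ∈ J, pr (c t) = t := by
  constructor
  · rintro ⟨hc, hsec, hint⟩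
    have hjet : ∀ t ∈ J, tdot pr (prolong E c t) = 1 := fun t ht => by
      have h1 := hasDerivAt_comp_curve hpr ((hc.contMDiffAt (hJ.mem_nhds ht)).mdifferentiableAt (by simp))
      refine h1.unique ((hasDerivAt_id t).congr_of_eventuallyEq ?_)
      filter_upwards [hJ.mem_nhds ht] with s hs using hsec s hs
    exact ⟨⟨⟨hc, (isMIntegralCurveOn_congr_field fun t ht => hξ _ (hjet t ht)).1 hint⟩, hjet⟩, hsec⟩
  · rintro ⟨⟨⟨hc, hint⟩, hjet⟩, hsec⟩
    exact ⟨hc, hsec, (isMIntegralCurveOn_congr_field fun t ht => hξ _ (hjet t ht)).2 hint⟩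

theorem exists_isSolutionOn_shift (hpr : ContMDiff 𝓘(ℝ, E) 𝓘(ℝ, ℝ) ∞ pr)
    (hξ : ∀ v ∈ jetSpace (E := E) pr, ξ.toFun v = K.geodesicField v) (hJ : IsOpen J)
    (hJc : J.OrdConnected) (h : K.IsUnitTimeGeodesicOn pr c J) :
    ∃ a : ℝ, ξ.IsSolutionOn (fun t => c (t - a)) ((fun t => t - a) ⁻¹' J) := by
  obtain ⟨⟨hc, hint⟩, hjet⟩ := h
  obtain ⟨a, ha⟩ := exists_eqOn_add_const_of_hasDerivAt_one hJ hJc fun t ht =>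
    hjet t ht ▸ hasDerivAt_comp_curve hpr ((hc.contMDiffAt (hJ.mem_nhds ht)).mdifferentiableAt (by simp))
  refine ⟨a, hc.comp ?_ fun t ht => ht, fun t ht => ?_, ?_⟩
  · exact (contDiff_id.sub contDiff_const).contMDiff.contMDiffOn
  · exact (ha _ ht).trans (sub_add_cancel t a)
  · rw [prolong_comp_sub]
    exact isMIntegralCurveOn_comp_sub.2
      ((isMIntegralCurveOn_congr_field fun t ht => hξ _ (hjet t ht)).2 hint)

end Connections

end NonRelMech

theorem theorem1p5
    {E : Type*} [NormedAddCommGroup E] [NormedSpace ℝ E] [FiniteDimensional ℝ E]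
    {Q : Type*} [TopologicalSpace Q] [T2Space Q] [SecondCountableTopology Q]
    [ChartedSpace E Q] [IsManifold 𝓘(ℝ, E) ∞ Q]
    {F : Type*} [NormedAddCommGroup F] [NormedSpace ℝ F] [FiniteDimensional ℝ F]
    {M : Type*} [TopologicalSpace M] [ChartedSpace F M] [IsManifold 𝓘(ℝ, F) ∞ M]
    (pr : Q → ℝ) (h_pr : NonRelMech.IsSmoothFibreBundle (E := E) F M pr)
    (ξ : NonRelMech.DynamicEquation (E := E) pr) :
    (∃ γ : NonRelMech.DynamicConnection (E := E) pr, γ.Yields ξ) ∧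
    ∀ γ : NonRelMech.DynamicConnection (E := E) pr, γ.Yields ξ →
      (∃ K : NonRelMech.TangentConnection E Q, K.TimeComponentsVanish pr ∧ K.Extends γ) ∧
      ∀ K : NonRelMech.TangentConnection E Q, K.TimeComponentsVanish pr → K.Extends γ →
        (∀ v ∈ NonRelMech.jetSpace (E := E) pr, ξ.toFun v = K.geodesicField v) ∧
        ∀ (c : ℝ → Q) (J : Set ℝ), IsOpen J → J.OrdConnected →
          (ξ.IsSolutionOn c J ↔
            K.IsUnitTimeGeodesicOn pr c J ∧ ∀ t ∈ J, pr (c t) = t) ∧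
          (K.IsUnitTimeGeodesicOn pr c J →
            ∃ a : ℝ, ξ.IsSolutionOn (fun t => c (t - a)) ((fun t => t - a) ⁻¹' J)) := by
  have hpr := h_pr.contMDiff
  obtain ⟨X⟩ := NonRelMech.exists_referenceFrame hpr h_pr.exists_mfderiv_eq_one
  obtain ⟨K₀, hK₀⟩ := NonRelMech.exists_tangentConnection hpr X
  refine ⟨⟨K₀.toDynamicConnection hpr hK₀ ξ, K₀.toDynamicConnection_yields hpr hK₀ ξ⟩,
    fun γ hγ => ⟨⟨γ.extend X hpr, γ.extend_timeComponentsVanish X hpr, γ.extend_extends X hpr⟩,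
      fun K _ hK => ?_⟩⟩
  have hξ : ∀ v ∈ NonRelMech.jetSpace (E := E) pr, ξ.toFun v = K.geodesicField v := fun v hv =>
    (hγ v hv).symm.trans (hK v hv v.2).symm
  exact ⟨hξ, fun c J hJ hJc =>
    ⟨NonRelMech.isSolutionOn_iff hpr hξ hJ, NonRelMech.exists_isSolutionOn_shift hpr hξ hJ hJc⟩⟩
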